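/- For $e\in S^1\subset\mathbb{R}^2$ let $\rho_e(x)=x\cdot e$, and let $\mathcal{H}^s$ denote the $s$-dimensional Hausdorff outer measure. A family $\mathcal{L}$ of (non-degenerate) line segments in $\mathbb{R}^2$ perpendicular to $e$ is called $s$-dimensional, $s\in[0,1]$, if $\mathcal{H}^s\bigl(\rho_e(\bigcup\mathcal{L})\bigr)>0$, and positive-dimensional if it is $s$-dimensional for some $s\in(0,1]$. Theorem. Let $K\subset\mathbb{R}^2$ be compact, and let $E\subset S^1$ be a (not necessarily measurable) set with $\mathcal{H}^1(E)>0$ such that for every $e\in E$ there is a positive-dimensional family $\mathcal{L}_e$ of line segments perpendicular to $e$ with $\bigcup\mathcal{L}_e\subset K$. (The dimension $s=s(e)$ may depend on $e$, and no measurability is assumed of $\bigcup\mathcal{L}_e$ or its projection.) Then $\mathcal{L}^2(K)>0$, where $\mathcal{L}^2$ is Lebesgue measure. -/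

import Mathlib

open MeasureTheory
open scoped MeasureTheory

/-- The Euclidean plane. -/
abbrev Plane : Type := EuclideanSpace ℝ (Fin 2)

/-- The orthogonal projection `x ↦ x · e` in the direction `e`. -/
noncomputable def proj (e x : Plane) : ℝ := inner ℝ x e

/-- `ℓ` is a (closed, non-degenerate) line segment perpendicular to `e`. -/
def IsPerpSegment (e : Plane) (ℓ : Set Plane) : Prop :=
  ∃ a b : Plane, a ≠ b ∧ inner ℝ (b - a) e = 0 ∧ ℓ = segment ℝ a b

/-- `𝓛` is an `s`-dimensional family of line segments perpendicular to `e`: the projection of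
its union in the direction `e` has positive `s`-dimensional Hausdorff (outer) measure. -/
def IsDimensionalFamily (s : ℝ) (e : Plane) (𝓛 : Set (Set Plane)) : Prop :=
  (∀ ℓ ∈ 𝓛, IsPerpSegment e ℓ) ∧ 0 < Measure.hausdorffMeasure s (proj e '' ⋃₀ 𝓛)

/-- `𝓛` is a positive-dimensional family of line segments perpendicular to `e`. -/
def IsPositiveDimensionalFamily (e : Plane) (𝓛 : Set (Set Plane)) : Prop :=
  ∃ s : ℝ, 0 < s ∧ s ≤ 1 ∧ IsDimensionalFamily s e 𝓛

/-!
The set `K` has positive area because it contains a family of segments of "dimension `1 + s`",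
which exceeds `1` by a definite amount.

Write the segments as pieces of lines `y = a * x + b`. Outer measures are countably subadditive, so
by pigeonholing over rational `p < q` and over lower bounds `1 / (n + 1)` for the dimension
and `1 / (N + 1)` for the content, there is a set `A` of slopes of positive outer measure such that,
for each `a ∈ A`, the set of `b` for which the line contributes its whole part over `[p, q]` to `K`
has `s`-dimensional Hausdorff content bounded below, with `s`, `p`, `q` and the bound independent
of `a` (`exists_le_hausdorffContent_intercepts`, `hausdorffMeasure_slopes_pos`). No measurability is
needed for this, nor later on.

It then suffices to bound from below, uniformly in `n`, the area of the `δ`-neighbourhood of `K`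
for `δ = 2 ^ (-n)`, because `K` is compact. At scale `δ`, the discrete Frostman lemma
(`exists_frostman_weights`) provides finitely many weighted slopes in `A` and, for each of them,
finitely many weighted intercepts, with total weights bounded below; an interval of length
`r ≥ δ` has slope weight `O(r)` and intercept weight `O(r ^ s)`. Two `δ`-strips whose slopes
differ by `t ≥ δ` overlap in area `O(δ ^ 2 / t)`, and overlap at all only if their intercepts differ
by `O(t)`. Hence the weighted overlap of one strip with all the others is at most a multiple of
`δ ^ 2 * ∑ k, 2 ^ k * (2 ^ (-k) * 2 ^ (-k * s))`, a convergent geometric series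
(`sum_weight_mul_volumeReal_strip_inter_le`), and the Cauchy–Schwarz inequality
(`sq_sum_measureReal_le`) bounds the area of the union of the strips below.
-/

/-! ### Hausdorff content and Frostman weights on the line -/

/-- The `s`-dimensional Hausdorff content `𝓗^s_∞` on the real line. Unlike the Hausdorff measure it
places no restriction on the diameters of the covering sets. -/
noncomputable def hausdorffContent (s : ℝ) : OuterMeasure ℝ :=
  OuterMeasure.boundedBy fun S : Set ℝ => Metric.ediam S ^ s

theorem hausdorffContent_le_ediam_rpow (s : ℝ) (S : Set ℝ) :
    hausdorffContent s S ≤ Metric.ediam S ^ s :=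
  OuterMeasure.boundedBy_le S

theorem hausdorffMeasure_eq_zero_of_hausdorffContent_eq_zero {s : ℝ} (hs : 0 < s) {S : Set ℝ}
    (h : hausdorffContent s S = 0) : Measure.hausdorffMeasure s S = 0 := by
  rw [Measure.hausdorffMeasure_apply, ← nonpos_iff_eq_zero]
  refine iSup₂_le fun r hr => le_of_forall_gt fun ε hε => ?_
  -- A cover of total content below `r ^ s` automatically consists of sets of diameter at most `r`.
  have hη : 0 < min ε (r ^ s) := lt_min hε (ENNReal.rpow_pos_of_nonneg hr hs.le)
  rw [← h, hausdorffContent, OuterMeasure.boundedBy_apply] at hη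
  simp only [iInf_lt_iff] at hη
  obtain ⟨t, hSt, ht⟩ := hη
  simp only [iInf_lt_iff]
  refine ⟨t, hSt, fun n => ?_, ht.trans_le (min_le_left _ _)⟩
  rcases (t n).eq_empty_or_nonempty with h0 | h0
  · simp [h0]
  · rw [← ENNReal.rpow_le_rpow_iff hs]
    refine le_trans ?_ (ht.le.trans (min_le_right _ _))
    refine le_trans ?_ (ENNReal.le_tsum n)
    exact le_iSup (fun _ : (t n).Nonempty => Metric.ediam (t n) ^ s) h0

/-- The half-open dyadic interval `[j / 2 ^ k, (j + 1) / 2 ^ k)`. -/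
def dyadicInterval (k : ℕ) (j : ℤ) : Set ℝ := {x | ⌊x * 2 ^ k⌋ = j}

theorem mem_dyadicInterval {k : ℕ} {j : ℤ} {x : ℝ} :
    x ∈ dyadicInterval k j ↔ ⌊x * 2 ^ k⌋ = j := Iff.rfl

theorem floor_mul_two_pow_of_le {m k : ℕ} (h : m ≤ k) (x : ℝ) :
    ⌊x * 2 ^ m⌋ = ⌊x * 2 ^ k⌋ / 2 ^ (k - m) := by
  have h1 : x * 2 ^ m = (x * 2 ^ k) / ((2 ^ (k - m) : ℕ) : ℝ) := by
    obtain ⟨d, rfl⟩ := Nat.exists_eq_add_of_le h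
    simp only [Nat.add_sub_cancel_left]
    push_cast
    field_simp
    ring
  rw [h1, Int.floor_div_natCast]
  norm_num

theorem dyadicInterval_eq_union (m : ℕ) (j : ℤ) :
    dyadicInterval m j = dyadicInterval (m + 1) (2 * j) ∪ dyadicInterval (m + 1) (2 * j + 1) := by
  ext x
  simp only [Set.mem_union, mem_dyadicInterval, floor_mul_two_pow_of_le (Nat.le_succ m) x]
  simp only [Nat.succ_eq_add_one, Nat.add_sub_cancel_left, pow_one]
  omega

theorem ediam_dyadicInterval_le (m : ℕ) (j : ℤ) :
    Metric.ediam (dyadicInterval m j) ≤ ENNReal.ofReal ((2 ^ m)⁻¹) := by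
  refine Metric.ediam_le fun x hx y hy => ?_
  rw [edist_dist]
  refine ENNReal.ofReal_le_ofReal ?_
  rw [mem_dyadicInterval, Int.floor_eq_iff] at hx hy
  have h2 : (0 : ℝ) < 2 ^ m := by positivity
  rw [Real.dist_eq, ← one_div, le_div_iff₀ h2, ← abs_of_pos h2, ← abs_mul, abs_le]
  constructor <;> nlinarith

theorem hausdorffContent_inter_dyadicInterval_le {s : ℝ} (hs : 0 < s) (B : Set ℝ) (m : ℕ) (j : ℤ) :
    hausdorffContent s (B ∩ dyadicInterval m j) ≤ ENNReal.ofReal ((2 ^ m)⁻¹ ^ s) := by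
  refine (hausdorffContent_le_ediam_rpow _ _).trans ?_
  rw [← ENNReal.ofReal_rpow_of_nonneg (by positivity) hs.le]
  gcongr
  exact (Metric.ediam_mono Set.inter_subset_right).trans (ediam_dyadicInterval_le m j)

open Classical in
/-- Discrete Frostman lemma. At resolution `2 ^ (-n)`, every set in a dyadic interval supports
finitely many point masses whose total is at least its Hausdorff content, while every dyadic
interval of length at least `2 ^ (-n)` carries mass at most its length to the power `s`. -/
theorem exists_frostman_weights {s : ℝ} (hs : 0 < s) (B : Set ℝ) {m n : ℕ} (hmn : m ≤ n) (j : ℤ) :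
    ∃ (P : Finset ℝ) (w : ℝ → ℝ), (∀ x, 0 ≤ w x) ∧ (∀ x ∈ P, x ∈ B ∩ dyadicInterval m j) ∧
      hausdorffContent s (B ∩ dyadicInterval m j) ≤ ENNReal.ofReal (∑ x ∈ P, w x) ∧
      ∀ k, m ≤ k → k ≤ n → ∀ i : ℤ,
        ∑ x ∈ P with x ∈ dyadicInterval k i, w x ≤ (2 ^ k)⁻¹ ^ s := by
  induction hmn using Nat.decreasingInduction generalizing j with
  | self =>
    rcases (B ∩ dyadicInterval n j).eq_empty_or_nonempty with h0 | ⟨x, hx⟩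
    · refine ⟨∅, 0, fun _ => le_rfl, by simp, by simp [h0], fun k _ _ i => ?_⟩
      simpa using by positivity
    · refine ⟨{x}, fun _ => (2 ^ n)⁻¹ ^ s, fun _ => by positivity, by simpa using hx, ?_, ?_⟩
      · simpa using hausdorffContent_inter_dyadicInterval_le hs B n j
      · intro k hk hk' i
        obtain rfl := le_antisymm hk hk'
        refine (Finset.sum_le_sum_of_subset_of_nonneg (Finset.filter_subset _ _)
          fun _ _ _ => by positivity).trans ?_
        simp
  | of_succ m hmn ih =>
    obtain ⟨P, w, hw, hP, hc, hd⟩ := ih (2 * j)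
    obtain ⟨P', w', hw', hP', hc', hd'⟩ := ih (2 * j + 1)
    have hdisj : Disjoint P P' := by
      refine Finset.disjoint_left.2 fun x hx hx' => ?_
      have h1 := (hP x hx).2
      have h2 := (hP' x hx').2
      rw [mem_dyadicInterval] at h1 h2
      omega
    set v : ℝ → ℝ := fun x => if x ∈ P then w x else w' x with hv
    have hv0 : ∀ x, 0 ≤ v x := fun x => by
      simp only [hv]; split_ifs
      exacts [hw x, hw' x]
    have hsum : ∀ p : ℝ → Prop, ∑ x ∈ P ∪ P' with p x, v x =
        ∑ x ∈ P with p x, w x + ∑ x ∈ P' with p x, w' x := fun p => by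
      rw [Finset.filter_union, Finset.sum_union (Finset.disjoint_filter_filter hdisj)]
      congr 1
      · exact Finset.sum_congr rfl fun x hx => if_pos (Finset.mem_filter.1 hx).1
      · exact Finset.sum_congr rfl fun x hx =>
          if_neg fun h => Finset.disjoint_left.1 hdisj h (Finset.mem_filter.1 hx).1
    have hsum' : ∑ x ∈ P ∪ P', v x = ∑ x ∈ P, w x + ∑ x ∈ P', w' x := by
      simpa using hsum fun _ => True
    have hmem : ∀ x ∈ P ∪ P', x ∈ B ∩ dyadicInterval m j := fun x hx => by
      rw [dyadicInterval_eq_union]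
      rcases Finset.mem_union.1 hx with h | h
      · exact ⟨(hP x h).1, Or.inl (hP x h).2⟩
      · exact ⟨(hP' x h).1, Or.inr (hP' x h).2⟩
    have hcv : hausdorffContent s (B ∩ dyadicInterval m j) ≤
        ENNReal.ofReal (∑ x ∈ P ∪ P', v x) := by
      rw [hsum', ENNReal.ofReal_add (Finset.sum_nonneg fun x _ => hw x)
        (Finset.sum_nonneg fun x _ => hw' x), dyadicInterval_eq_union, Set.inter_union_distrib_left]
      exact (measure_union_le _ _).trans (add_le_add hc hc')
    -- A dyadic interval of level above `m` meets at most one of the two halves.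
    have hdv : ∀ k, m + 1 ≤ k → k ≤ n → ∀ i : ℤ,
        ∑ x ∈ P ∪ P' with x ∈ dyadicInterval k i, v x ≤ (2 ^ k)⁻¹ ^ s := fun k hk hkn i => by
      rw [hsum]
      have key : ∀ (Q : Finset ℝ) (l : ℤ), (∀ x ∈ Q, x ∈ B ∩ dyadicInterval (m + 1) l) →
          i / 2 ^ (k - (m + 1)) ≠ l → Q.filter (· ∈ dyadicInterval k i) = ∅ := by
        intro Q l hQ hne
        refine Finset.filter_eq_empty_iff.2 fun x hx hxi => hne ?_
        rw [← (hQ x hx).2, ← (hxi : _ = i)]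
        exact (floor_mul_two_pow_of_le hk x).symm
      by_cases h : i / 2 ^ (k - (m + 1)) = 2 * j
      · rw [key P' _ hP' (by omega)]
        simpa using hd k hk hkn i
      · rw [key P _ hP h]
        simpa using hd' k hk hkn i
    set t := ∑ x ∈ P ∪ P', v x with ht
    rcases le_or_gt t ((2 ^ m)⁻¹ ^ s) with hle | hlt
    · refine ⟨P ∪ P', v, hv0, hmem, hcv, fun k hk hkn i => ?_⟩
      rcases hk.eq_or_lt with rfl | hk
      · exact (Finset.sum_le_sum_of_subset_of_nonneg (Finset.filter_subset _ _)
          fun _ _ _ => hv0 _).trans hle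
      · exact hdv k hk hkn i
    · -- The mass is too large for the whole interval: scale it down to exactly the allowed amount.
      have hp : (0 : ℝ) < (2 ^ m)⁻¹ ^ s := by positivity
      have ht0 : 0 < t := hp.trans hlt
      set c := (2 ^ m)⁻¹ ^ s / t with hcdef
      have hc0 : 0 ≤ c := by positivity
      have hc1 : c ≤ 1 := (div_le_one ht0).2 hlt.le
      have htot : ∑ x ∈ P ∪ P', c * v x = (2 ^ m)⁻¹ ^ s := by
        rw [← Finset.mul_sum, ← ht, hcdef]
        field_simp
      refine ⟨P ∪ P', fun x => c * v x, fun x => mul_nonneg hc0 (hv0 x), hmem, ?_, ?_⟩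
      · rw [htot]
        exact hausdorffContent_inter_dyadicInterval_le hs B m j
      · intro k hk hkn i
        rcases hk.eq_or_lt with rfl | hk
        · exact (Finset.sum_le_sum_of_subset_of_nonneg (Finset.filter_subset _ _)
            fun _ _ _ => mul_nonneg hc0 (hv0 _)).trans htot.le
        · refine le_trans ?_ (hdv k hk hkn i)
          exact Finset.sum_le_sum fun x _ => mul_le_of_le_one_left (hv0 x) hc1

open Classical in
/-- A bound on the dyadic intervals of one level bounds the mass of every interval of comparable
length. -/
theorem sum_filter_abs_sub_le {P : Finset ℝ} {w : ℝ → ℝ} (hw : ∀ x, 0 ≤ w x) {k : ℕ} {b : ℝ}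
    (hb : ∀ i : ℤ, ∑ x ∈ P with x ∈ dyadicInterval k i, w x ≤ b) (L : ℕ) (y : ℝ) :
    ∑ x ∈ P with |y - x| ≤ L * (2 ^ k)⁻¹, w x ≤ (2 * L + 3) * b := by
  set I : Finset ℤ := Finset.Icc (⌊y * 2 ^ k⌋ - (L + 1)) (⌊y * 2 ^ k⌋ + (L + 1)) with hI
  have hmaps : ∀ x ∈ P.filter (fun x => |y - x| ≤ L * (2 ^ k)⁻¹), ⌊x * 2 ^ k⌋ ∈ I := by
    intro x hx
    have h2 : (0 : ℝ) < 2 ^ k := by positivity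
    have h := (Finset.mem_filter.1 hx).2
    rw [← div_eq_mul_inv, le_div_iff₀ h2, ← abs_of_pos h2, ← abs_mul, abs_le] at h
    have hx1 := Int.floor_le (x * 2 ^ k)
    have hx2 := Int.lt_floor_add_one (x * 2 ^ k)
    have hy1 := Int.floor_le (y * 2 ^ k)
    have hy2 := Int.lt_floor_add_one (y * 2 ^ k)
    rw [hI, Finset.mem_Icc]
    constructor
    · have : ((⌊y * 2 ^ k⌋ : ℤ) : ℝ) < ((⌊x * 2 ^ k⌋ + L + 1 : ℤ) : ℝ) := by push_cast; linarith
      have := Int.cast_lt.1 this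
      omega
    · have : ((⌊x * 2 ^ k⌋ : ℤ) : ℝ) < ((⌊y * 2 ^ k⌋ + L + 1 : ℤ) : ℝ) := by push_cast; linarith
      have := Int.cast_lt.1 this
      omega
  rw [← Finset.sum_fiberwise_of_maps_to hmaps]
  have hcard : (I.card : ℝ) = 2 * L + 3 := by
    rw [hI, Int.card_Icc]
    have : (⌊y * 2 ^ k⌋ + (L + 1) + 1 - (⌊y * 2 ^ k⌋ - (L + 1))).toNat = 2 * L + 3 := by omega
    rw [this]
    push_cast
    ring
  rw [← hcard]
  refine (Finset.sum_le_card_nsmul _ _ b fun i _ => le_trans ?_ (hb i)).trans_eq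
    (nsmul_eq_mul _ _)
  refine Finset.sum_le_sum_of_subset_of_nonneg ?_ fun _ _ _ => hw _
  intro x hx
  simp only [Finset.mem_filter] at hx ⊢
  exact ⟨hx.1.1, hx.2⟩

/-! ### Strips around lines -/

/-- The Cauchy–Schwarz inequality for `∑ wᵢ 1_{Tᵢ}`, an overlap bound for the measure of a set
containing all the `Tᵢ`. -/
theorem sq_sum_measureReal_le {α ι : Type*} [MeasurableSpace α] {μ : Measure α} (P : Finset ι)
    (w : ι → ℝ) {T : ι → Set α} {S : Set α} (hS : MeasurableSet S) (hSfin : μ S ≠ ⊤)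
    (hT : ∀ i ∈ P, MeasurableSet (T i)) (hTS : ∀ i ∈ P, T i ⊆ S) :
    (∑ i ∈ P, w i * μ.real (T i)) ^ 2 ≤
      μ.real S * ∑ i ∈ P, ∑ j ∈ P, w i * w j * μ.real (T i ∩ T j) := by
  set A := ∑ i ∈ P, w i * μ.real (T i) with hA
  set Q := ∑ i ∈ P, ∑ j ∈ P, w i * w j * μ.real (T i ∩ T j) with hQ
  set f : α → ℝ := fun x => ∑ i ∈ P, w i * (T i).indicator 1 x with hf
  have hint : ∀ U : Set α, MeasurableSet U → U ⊆ S → Integrable (U.indicator (1 : α → ℝ)) μ :=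
    fun U hU hUS => (integrable_indicator_iff hU).2
      (integrableOn_const (measure_ne_top_of_subset hUS hSfin))
  have hfint : Integrable f μ :=
    integrable_finsetSum _ fun i hi => (hint _ (hT i hi) (hTS i hi)).const_mul _
  have hfI : ∫ x, f x ∂μ = A := by
    rw [hf, integral_finsetSum _ fun i hi => (hint _ (hT i hi) (hTS i hi)).const_mul _, hA]
    refine Finset.sum_congr rfl fun i hi => ?_
    rw [integral_const_mul, integral_indicator_one (hT i hi)]
  have hff : ∀ x, f x * f x =
      ∑ i ∈ P, ∑ j ∈ P, w i * w j * (T i ∩ T j).indicator 1 x := fun x => by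
    simp only [hf, Finset.sum_mul_sum]
    refine Finset.sum_congr rfl fun i _ => Finset.sum_congr rfl fun j _ => ?_
    rw [Set.inter_indicator_one, Pi.mul_apply]
    ring
  have hint2 : ∀ i ∈ P, ∀ j ∈ P,
      Integrable (fun x => w i * w j * (T i ∩ T j).indicator (1 : α → ℝ) x) μ := fun i hi j hj =>
    (hint _ ((hT i hi).inter (hT j hj)) (Set.inter_subset_left.trans (hTS i hi))).const_mul _
  have hffint : Integrable (fun x => f x * f x) μ := by
    simp only [hff]
    exact integrable_finsetSum _ fun i hi => integrable_finsetSum _ fun j hj => hint2 i hi j hj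
  have hffI : ∫ x, f x * f x ∂μ = Q := by
    simp only [hff]
    rw [integral_finsetSum _ fun i hi => integrable_finsetSum _ fun j hj => hint2 i hi j hj, hQ]
    refine Finset.sum_congr rfl fun i hi => ?_
    rw [integral_finsetSum _ fun j hj => hint2 i hi j hj]
    refine Finset.sum_congr rfl fun j hj => ?_
    rw [integral_const_mul, integral_indicator_one ((hT i hi).inter (hT j hj))]
  have hquad : ∀ c : ℝ, 0 ≤ μ.real S * (c * c) + (-(2 * A)) * c + Q := fun c => by
    have h0 : 0 ≤ ∫ x, ((c * c) * S.indicator 1 x - (2 * c) * f x + f x * f x) ∂μ := by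
      refine integral_nonneg fun x => ?_
      by_cases hx : x ∈ S
      · simp only [Set.indicator_of_mem hx, Pi.one_apply, Pi.zero_apply]
        nlinarith [sq_nonneg (c - f x)]
      · have : f x = 0 := Finset.sum_eq_zero fun i hi => by
          rw [Set.indicator_of_notMem fun h => hx (hTS i hi h), mul_zero]
        simp [hx, this]
    rw [integral_add (f := fun x => (c * c) * S.indicator 1 x - (2 * c) * f x)
      (((hint S hS subset_rfl).const_mul _).sub (hfint.const_mul _)) hffint,
      integral_sub ((hint S hS subset_rfl).const_mul _) (hfint.const_mul _), integral_const_mul,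
      integral_const_mul, integral_indicator_one hS, hfI, hffI] at h0
    linarith
  have := discrim_le_zero hquad
  rw [discrim] at this
  nlinarith

/-- The vertical `δ`-neighbourhood of the graph of `x ↦ a * x + b` over `X`. -/
def strip (X : Set ℝ) (δ a b : ℝ) : Set (ℝ × ℝ) :=
  {z | z.1 ∈ X ∧ |z.2 - (a * z.1 + b)| ≤ δ}

theorem measurableSet_strip {X : Set ℝ} (hX : MeasurableSet X) (δ a b : ℝ) :
    MeasurableSet (strip X δ a b) := by
  refine (measurable_fst hX).inter (IsClosed.measurableSet ?_)
  exact isClosed_le (f := fun z : ℝ × ℝ => |z.2 - (a * z.1 + b)|) (by fun_prop) continuous_const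

theorem volume_strip {X : Set ℝ} (hX : MeasurableSet X) (δ a b : ℝ) :
    volume (strip X δ a b) = ENNReal.ofReal (2 * δ) * volume X := by
  rw [Measure.volume_eq_prod, Measure.prod_apply (measurableSet_strip hX δ a b)]
  have : ∀ x, volume (Prod.mk x ⁻¹' strip X δ a b) =
      X.indicator (fun _ => ENNReal.ofReal (2 * δ)) x := fun x => by
    by_cases hx : x ∈ X
    · rw [Set.indicator_of_mem hx, ← Real.volume_closedBall (a * x + b) δ]
      congr 1
      ext y
      simp [strip, hx, Real.dist_eq]
    · simp [strip, hx]
  simp only [this]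
  rw [lintegral_indicator hX, setLIntegral_const]

theorem volumeReal_strip {X : Set ℝ} (hX : MeasurableSet X) {δ : ℝ} (hδ : 0 ≤ δ) (a b : ℝ) :
    volume.real (strip X δ a b) = 2 * δ * volume.real X := by
  rw [measureReal_def, volume_strip hX, ENNReal.toReal_mul, ENNReal.toReal_ofReal (by positivity),
    measureReal_def]

/-- Two strips over the same interval meet above a set of abscissae of length `O(δ / |a - a'|)`. -/
theorem volumeReal_strip_inter_le {p q δ : ℝ} (hδ : 0 ≤ δ) (a b a' b' : ℝ) {r : ℝ} (hr : 0 ≤ r)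
    (h : q - p ≤ r ∨ 4 * δ ≤ r * |a - a'| ∧ a ≠ a') (hpq : p ≤ q) :
    volume.real (strip (Set.Icc p q) δ a b ∩ strip (Set.Icc p q) δ a' b') ≤ 2 * δ * r := by
  suffices ∃ u v : ℝ, u ≤ v ∧ v - u ≤ r ∧
      strip (Set.Icc p q) δ a b ∩ strip (Set.Icc p q) δ a' b' ⊆ strip (Set.Icc u v) δ a b by
    obtain ⟨u, v, huv, hle, hsub⟩ := this
    have hfin : volume (strip (Set.Icc u v) δ a b) ≠ ⊤ := by
      rw [volume_strip measurableSet_Icc, Real.volume_Icc]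
      exact ENNReal.mul_ne_top ENNReal.ofReal_ne_top ENNReal.ofReal_ne_top
    refine (measureReal_mono hsub hfin).trans ?_
    rw [volumeReal_strip measurableSet_Icc hδ, Real.volume_real_Icc_of_le huv]
    gcongr
  rcases h with h | ⟨h, hne⟩
  · exact ⟨p, q, hpq, h, Set.inter_subset_left⟩
  · have hpos : 0 < |a - a'| := abs_pos.2 (sub_ne_zero.2 hne)
    set c := (b' - b) / (a - a') with hc
    refine ⟨c - r / 2, c + r / 2, by linarith, by linarith, ?_⟩
    rintro ⟨x, y⟩ ⟨⟨hx, hy⟩, -, hy'⟩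
    refine ⟨?_, hy⟩
    simp only at hy hy' ⊢
    have h1 : (a - a') * (x - c) = (y - (a' * x + b')) - (y - (a * x + b)) := by
      rw [hc, mul_sub, mul_div_cancel₀ _ (sub_ne_zero.2 hne)]
      ring
    have h2 : |a - a'| * |x - c| ≤ 2 * δ := by
      rw [← abs_mul, h1]
      exact (abs_sub _ _).trans (by linarith)
    have h3 : |x - c| ≤ r / 2 := by
      refine le_of_mul_le_mul_left ?_ hpos
      linarith
    rw [abs_le] at h3
    exact ⟨by linarith, by linarith⟩

/-- Strips that meet have intercepts no further apart than a multiple of `|a - a'| + δ`. -/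
theorem abs_sub_le_of_strip_inter_nonempty {p q δ : ℝ} {M : ℝ} (hM : |p| ≤ M) (hM' : |q| ≤ M)
    {a b a' b' : ℝ}
    (h : (strip (Set.Icc p q) δ a b ∩ strip (Set.Icc p q) δ a' b').Nonempty) :
    |b - b'| ≤ M * |a - a'| + 2 * δ := by
  obtain ⟨⟨x, y⟩, ⟨hx, hy⟩, -, hy'⟩ := h
  simp only at hx hy hy'
  have hxM : |x| ≤ M := abs_le.2
    ⟨(neg_le_of_abs_le hM).trans hx.1, hx.2.trans (le_of_abs_le hM')⟩
  have h1 : b - b' = ((y - (a' * x + b')) - (y - (a * x + b))) - (a - a') * x := by ring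
  have h2 : |(a - a') * x| ≤ M * |a - a'| := by
    rw [abs_mul, mul_comm]
    gcongr
  rw [h1]
  refine (abs_sub _ _).trans ?_
  have := abs_sub (y - (a' * x + b')) (y - (a * x + b))
  linarith

open Classical in
/-- The overlap of two strips of width `2 ^ (-n)`, decomposed according to the dyadic size of the
difference of slopes. -/
theorem volumeReal_strip_inter_le_sum {p q : ℝ} (hpq : p ≤ q) {L : ℕ} (hp : |p| + 2 ≤ L)
    (hq : |q| + 2 ≤ L) (n : ℕ) {a b a' b' : ℝ} (ha : |a - a'| ≤ 1) :
    volume.real (strip (Set.Icc p q) (2 ^ n)⁻¹ a b ∩ strip (Set.Icc p q) (2 ^ n)⁻¹ a' b') ≤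
      2 * ((2 ^ n)⁻¹ * (2 ^ n)⁻¹) * (8 + (q - p)) * ∑ k ∈ Finset.range (n + 1), 2 ^ k *
        if |a - a'| ≤ (2 ^ k)⁻¹ ∧ |b - b'| ≤ L * (2 ^ k)⁻¹ then 1 else 0 := by
  have hq0 : 0 ≤ q - p := sub_nonneg.2 hpq
  rcases Set.eq_empty_or_nonempty
    (strip (Set.Icc p q) (2 ^ n)⁻¹ a b ∩ strip (Set.Icc p q) (2 ^ n)⁻¹ a' b') with h0 | hne
  · rw [h0, measureReal_empty]
    refine mul_nonneg (by positivity) (Finset.sum_nonneg fun k _ => mul_nonneg (by positivity) ?_)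
    split_ifs <;> norm_num
  have hb := abs_sub_le_of_strip_inter_nonempty (M := L - 2) (by linarith) (by linarith) hne
  -- `k` is the finest level, up to `n`, at which the slopes are still close.
  obtain ⟨k, hkn, hk, hmax⟩ : ∃ k ≤ n, |a - a'| ≤ (2 ^ k)⁻¹ ∧
      (k = n ∨ (2 ^ (k + 1))⁻¹ < |a - a'|) := by
    set k := Nat.findGreatest (fun k => |a - a'| ≤ (2 ^ k)⁻¹) n with hk
    refine ⟨k, Nat.findGreatest_le n, ?_, ?_⟩
    · exact Nat.findGreatest_spec (P := fun k => |a - a'| ≤ (2 ^ k)⁻¹) (Nat.zero_le n)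
        (by simpa using ha)
    · rcases (Nat.findGreatest_le (P := fun k => |a - a'| ≤ (2 ^ k)⁻¹) n).eq_or_lt with h | h
      · exact Or.inl h
      · exact Or.inr (not_le.1 (Nat.findGreatest_is_greatest (Nat.lt_succ_self _) h))
  have hnk : ((2 : ℝ) ^ n)⁻¹ ≤ (2 ^ k)⁻¹ := by
    gcongr
    norm_num
  have hbk : |b - b'| ≤ L * (2 ^ k)⁻¹ := by
    have : (L - 2 : ℝ) * |a - a'| ≤ (L - 2) * (2 ^ k)⁻¹ :=
      mul_le_mul_of_nonneg_left hk (by linarith [abs_nonneg p])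
    linarith
  have hterm : (2 : ℝ) ^ k ≤ ∑ k ∈ Finset.range (n + 1), 2 ^ k *
        if |a - a'| ≤ (2 ^ k)⁻¹ ∧ |b - b'| ≤ L * (2 ^ k)⁻¹ then (1 : ℝ) else 0 := by
    have hnn : ∀ k ∈ Finset.range (n + 1), (0 : ℝ) ≤ 2 ^ k *
        if |a - a'| ≤ (2 ^ k)⁻¹ ∧ |b - b'| ≤ L * (2 ^ k)⁻¹ then (1 : ℝ) else 0 := fun k _ => by
      refine mul_nonneg (by positivity) ?_
      split_ifs <;> norm_num
    refine le_trans (le_of_eq ?_)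
      (Finset.single_le_sum hnn (Finset.mem_range.2 (Nat.lt_succ_of_le hkn)))
    rw [if_pos ⟨hk, hbk⟩, mul_one]
  refine (volumeReal_strip_inter_le (by positivity) a b a' b'
    (r := (2 ^ n)⁻¹ * (8 + (q - p)) * 2 ^ k) (by positivity) ?_ hpq).trans ?_
  · rcases hmax with rfl | hlt
    · left
      have : ((2 : ℝ) ^ k)⁻¹ * (8 + (q - p)) * 2 ^ k = 8 + (q - p) := by field_simp
      linarith
    · right
      have h2 : (2 ^ (k + 1) : ℝ)⁻¹ = (2 ^ k)⁻¹ / 2 := by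
        rw [pow_succ, mul_inv, div_eq_mul_inv]
      refine ⟨?_, fun h => ?_⟩
      · have hc : (2 : ℝ) ^ k * (2 ^ k)⁻¹ = 1 := by field_simp
        have h3 : 1 / 2 ≤ 2 ^ k * |a - a'| := by
          rw [h2] at hlt
          have := mul_le_mul_of_nonneg_left hlt.le (by positivity : (0 : ℝ) ≤ 2 ^ k)
          linarith
        calc 4 * ((2 : ℝ) ^ n)⁻¹ = (2 ^ n)⁻¹ * 8 * (1 / 2) := by ring
          _ ≤ (2 ^ n)⁻¹ * (8 + (q - p)) * (2 ^ k * |a - a'|) := by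
            gcongr
            linarith
          _ = _ := by ring
      · rw [h, sub_self, abs_zero] at hlt
        exact absurd hlt (not_lt.2 (by positivity))
  · calc 2 * ((2 : ℝ) ^ n)⁻¹ * ((2 ^ n)⁻¹ * (8 + (q - p)) * 2 ^ k)
        = 2 * ((2 ^ n)⁻¹ * (2 ^ n)⁻¹) * (8 + (q - p)) * 2 ^ k := by ring
      _ ≤ _ := by gcongr

/-! ### Unions of segments with many slopes and many intercepts -/

open Classical in
/-- The overlap estimate for strips carrying product-type Frostman weights, of exponent `1` in the
slope and `s` in the intercept: the gain `2 ^ (-k * s)` from the intercepts makes the sum over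
dyadic slope differences converge, where `s = 0` would lose a factor `n`. -/
theorem sum_weight_mul_volumeReal_strip_inter_le {p q : ℝ} (hpq : p ≤ q) {L : ℕ}
    (hp : |p| + 2 ≤ L) (hq : |q| + 2 ≤ L) {s : ℝ} (hs : 0 < s) (n : ℕ)
    {PA : Finset ℝ} {wA : ℝ → ℝ} (hwA : ∀ a, 0 ≤ wA a)
    (hA : ∀ k ≤ n, ∀ i : ℤ, ∑ a ∈ PA with a ∈ dyadicInterval k i, wA a ≤ (2 ^ k)⁻¹)
    {PB : ℝ → Finset ℝ} {wB : ℝ → ℝ → ℝ} (hwB : ∀ a b, 0 ≤ wB a b)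
    (hB : ∀ a ∈ PA, ∀ k ≤ n, ∀ j : ℤ,
      ∑ b ∈ PB a with b ∈ dyadicInterval k j, wB a b ≤ (2 ^ k)⁻¹ ^ s)
    {a b : ℝ} (ha : ∀ a' ∈ PA, |a - a'| ≤ 1) :
    ∑ a' ∈ PA, ∑ b' ∈ PB a', wA a' * wB a' b' *
        volume.real (strip (Set.Icc p q) (2 ^ n)⁻¹ a b ∩ strip (Set.Icc p q) (2 ^ n)⁻¹ a' b') ≤
      2 * ((2 ^ n)⁻¹ * (2 ^ n)⁻¹) * (8 + (q - p)) *
        (5 * (2 * L + 3) * ∑' k : ℕ, ((2⁻¹ : ℝ) ^ s) ^ k) := by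
  have hq0 : 0 ≤ q - p := sub_nonneg.2 hpq
  set D := 2 * (((2 : ℝ) ^ n)⁻¹ * (2 ^ n)⁻¹) * (8 + (q - p)) with hD
  have hD0 : 0 ≤ D := by positivity
  -- The mass of the lines whose parameters are `2 ^ (-k)`-close to `(a, b)`.
  have hmass : ∀ k ≤ n, ∑ a' ∈ PA, ∑ b' ∈ PB a', wA a' * wB a' b' *
      (if |a - a'| ≤ (2 ^ k)⁻¹ ∧ |b - b'| ≤ L * (2 ^ k)⁻¹ then 1 else 0) ≤
        (2 ^ k)⁻¹ * (5 * (2 * L + 3) * ((2⁻¹ : ℝ) ^ s) ^ k) := fun k hk => by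
    have h2k : ((2 : ℝ) ^ k)⁻¹ ^ s = ((2⁻¹ : ℝ) ^ s) ^ k := by
      rw [← inv_pow, ← Real.rpow_natCast, ← Real.rpow_natCast, ← Real.rpow_mul (by norm_num),
        ← Real.rpow_mul (by norm_num), mul_comm]
    calc ∑ a' ∈ PA, ∑ b' ∈ PB a', wA a' * wB a' b' *
          (if |a - a'| ≤ (2 ^ k)⁻¹ ∧ |b - b'| ≤ L * (2 ^ k)⁻¹ then (1 : ℝ) else 0)
        = ∑ a' ∈ PA with |a - a'| ≤ (1 : ℕ) * (2 ^ k)⁻¹,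
            wA a' * ∑ b' ∈ PB a' with |b - b'| ≤ L * (2 ^ k)⁻¹, wB a' b' := by
          rw [Finset.sum_filter]
          refine Finset.sum_congr rfl fun a' _ => ?_
          rw [Nat.cast_one, one_mul]
          split_ifs with h
          · rw [Finset.sum_filter, Finset.mul_sum]
            refine Finset.sum_congr rfl fun b' _ => ?_
            by_cases h' : |b - b'| ≤ L * (2 ^ k)⁻¹ <;> simp [h, h']
          · simp [h]
      _ ≤ ∑ a' ∈ PA with |a - a'| ≤ (1 : ℕ) * (2 ^ k)⁻¹,
            wA a' * ((2 * L + 3) * (2 ^ k)⁻¹ ^ s) := by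
          refine Finset.sum_le_sum fun a' ha' => mul_le_mul_of_nonneg_left ?_ (hwA a')
          exact sum_filter_abs_sub_le (hwB a') (hB a' (Finset.mem_filter.1 ha').1 k hk) L b
      _ ≤ ((2 * (1 : ℕ) + 3) * (2 ^ k)⁻¹) * ((2 * L + 3) * (2 ^ k)⁻¹ ^ s) := by
          rw [← Finset.sum_mul]
          exact mul_le_mul_of_nonneg_right (sum_filter_abs_sub_le hwA (hA k hk) 1 a)
            (by positivity)
      _ = _ := by
          rw [h2k]
          push_cast
          ring
  calc ∑ a' ∈ PA, ∑ b' ∈ PB a', wA a' * wB a' b' *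
        volume.real (strip (Set.Icc p q) (2 ^ n)⁻¹ a b ∩ strip (Set.Icc p q) (2 ^ n)⁻¹ a' b')
      ≤ ∑ a' ∈ PA, ∑ b' ∈ PB a', wA a' * wB a' b' * (D * ∑ k ∈ Finset.range (n + 1), 2 ^ k *
          if |a - a'| ≤ (2 ^ k)⁻¹ ∧ |b - b'| ≤ L * (2 ^ k)⁻¹ then 1 else 0) := by
        refine Finset.sum_le_sum fun a' ha' => Finset.sum_le_sum fun b' _ => ?_
        exact mul_le_mul_of_nonneg_left
          (volumeReal_strip_inter_le_sum hpq hp hq n (ha a' ha')) (mul_nonneg (hwA _) (hwB _ _))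
    _ = D * ∑ k ∈ Finset.range (n + 1), 2 ^ k * ∑ a' ∈ PA, ∑ b' ∈ PB a', wA a' * wB a' b' *
          (if |a - a'| ≤ (2 ^ k)⁻¹ ∧ |b - b'| ≤ L * (2 ^ k)⁻¹ then 1 else 0) := by
        simp only [Finset.mul_sum]
        rw [Finset.sum_comm (s := Finset.range (n + 1))]
        refine Finset.sum_congr rfl fun a' _ => ?_
        rw [Finset.sum_comm]
        refine Finset.sum_congr rfl fun k _ => Finset.sum_congr rfl fun b' _ => ?_
        ring
    _ ≤ D * ∑ k ∈ Finset.range (n + 1), 5 * (2 * L + 3) * ((2⁻¹ : ℝ) ^ s) ^ k := by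
        refine mul_le_mul_of_nonneg_left (Finset.sum_le_sum fun k hk => ?_) hD0
        have hk' : k ≤ n := Nat.lt_succ_iff.1 (Finset.mem_range.1 hk)
        refine (mul_le_mul_of_nonneg_left (hmass k hk') (by positivity)).trans_eq ?_
        rw [← mul_assoc, mul_inv_cancel₀ (by positivity), one_mul]
    _ ≤ _ := by
        rw [← Finset.mul_sum]
        gcongr
        refine Summable.sum_le_tsum _ (fun k _ => by positivity) ?_
        exact summable_geometric_of_lt_one (by positivity)
          (Real.rpow_lt_one (by norm_num) (by norm_num) hs)

/-- The intercepts `b` of the lines `y = a * x + b` whose part over `[p, q]` lies in `K`. -/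
def intercepts (K : Set (ℝ × ℝ)) (p q a : ℝ) : Set ℝ :=
  {b | ∀ x ∈ Set.Icc p q, (x, a * x + b) ∈ K}

/-- A compact set in the plane has positive area if, for slopes in a set of positive
one-dimensional content, it contains the segments over a fixed interval for a set of intercepts
whose `s`-dimensional content is bounded below, for some `s > 0`. -/
theorem volume_pos_of_hausdorffContent_intercepts {K : Set (ℝ × ℝ)} (hK : IsCompact K) {p q : ℝ}
    (hpq : p < q) {s c : ℝ} (hs : 0 < s) (hc : 0 < c) {A : Set ℝ} {i j : ℤ}
    (hA : 0 < hausdorffContent 1 (A ∩ dyadicInterval 0 i))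
    (hB : ∀ a ∈ A, ENNReal.ofReal c ≤ hausdorffContent s
      (intercepts K p q a ∩ dyadicInterval 0 j)) :
    0 < volume K := by
  classical
  obtain ⟨L, hL⟩ := exists_nat_ge (max (|p| + 2) (|q| + 2))
  set cA := (hausdorffContent 1 (A ∩ dyadicInterval 0 i)).toReal with hcA
  have hAfin : hausdorffContent 1 (A ∩ dyadicInterval 0 i) ≠ ⊤ :=
    ne_top_of_le_ne_top ENNReal.ofReal_ne_top
      (hausdorffContent_inter_dyadicInterval_le one_pos A 0 i)
  have hcA0 : 0 < cA := ENNReal.toReal_pos hA.ne' hAfin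
  set G := ∑' k : ℕ, ((2⁻¹ : ℝ) ^ s) ^ k with hG
  have hG0 : 0 < G := by
    refine (summable_geometric_of_lt_one (by positivity)
      (Real.rpow_lt_one (by norm_num) (by norm_num) hs)).tsum_pos (fun k => by positivity) 0 ?_
    simp
  have hqp : 0 < q - p := sub_pos.2 hpq
  set C := 2 * (8 + (q - p)) * (5 * (2 * L + 3) * G) with hC
  have hC0 : 0 < C := by positivity
  have key : ∀ n : ℕ, ENNReal.ofReal (4 * (q - p) ^ 2 * (cA * c) / C) ≤
      volume (Metric.cthickening ((2 : ℝ) ^ n)⁻¹ K) := fun n => by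
    obtain ⟨PA, wA, hwA, hPA, hsA, hdA⟩ := exists_frostman_weights one_pos A (Nat.zero_le n) i
    have hBex : ∀ a : ℝ, ∃ (P : Finset ℝ) (w : ℝ → ℝ), (∀ x, 0 ≤ w x) ∧
        (∀ b ∈ P, ∀ x ∈ Set.Icc p q, (x, a * x + b) ∈ K) ∧ (a ∈ A → c ≤ ∑ x ∈ P, w x) ∧
        ∀ k ≤ n, ∀ j : ℤ, ∑ x ∈ P with x ∈ dyadicInterval k j, w x ≤ (2 ^ k)⁻¹ ^ s := fun a => by
      obtain ⟨P, w, hw, hP, hsum, hd⟩ := exists_frostman_weights hs (intercepts K p q a) (Nat.zero_le n) j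
      refine ⟨P, w, hw, fun b hb => (hP b hb).1, fun ha => ?_, fun k => hd k (Nat.zero_le k)⟩
      exact (ENNReal.ofReal_le_ofReal_iff (Finset.sum_nonneg fun x _ => hw x)).1
        ((hB a ha).trans hsum)
    choose PB wB hwB hPB hsB hdB using hBex
    set δ : ℝ := ((2 : ℝ) ^ n)⁻¹ with hδ
    have hδ0 : 0 < δ := by positivity
    set S := Metric.cthickening δ K with hS
    have hScomp : IsCompact S := hK.cthickening
    set P := PA.sigma PB with hP
    set w : (Σ _ : ℝ, ℝ) → ℝ := fun l => wA l.1 * wB l.1 l.2 with hw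
    set T : (Σ _ : ℝ, ℝ) → Set (ℝ × ℝ) := fun l => strip (Set.Icc p q) δ l.1 l.2 with hT
    have hw0 : ∀ l, 0 ≤ w l := fun l => mul_nonneg (hwA _) (hwB _ _)
    have hTS : ∀ l ∈ P, T l ⊆ S := by
      rintro ⟨a, b⟩ hl ⟨x, y⟩ ⟨hx, hy⟩
      refine Metric.mem_cthickening_of_dist_le _ _ _ _ (hPB a b (Finset.mem_sigma.1 hl).2 x hx) ?_
      rw [Prod.dist_eq, Real.dist_eq, Real.dist_eq]
      simpa [hδ0.le] using hy
    have hCS := sq_sum_measureReal_le (μ := volume) P w hScomp.measurableSet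
      hScomp.measure_lt_top.ne (fun l _ => measurableSet_strip measurableSet_Icc δ l.1 l.2) hTS
    set W := ∑ l ∈ P, w l with hW
    have hWle : cA * c ≤ W := by
      have h1 : cA ≤ ∑ a ∈ PA, wA a :=
        ENNReal.toReal_le_of_le_ofReal (Finset.sum_nonneg fun x _ => hwA x) hsA
      calc cA * c ≤ (∑ a ∈ PA, wA a) * c := by gcongr
        _ = ∑ a ∈ PA, wA a * c := Finset.sum_mul _ _ _
        _ ≤ ∑ a ∈ PA, wA a * ∑ b ∈ PB a, wB a b := Finset.sum_le_sum fun a ha =>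
            mul_le_mul_of_nonneg_left (hsB a (hPA a ha).1) (hwA a)
        _ = W := by simp only [hW, hP, hw, Finset.sum_sigma, Finset.mul_sum]
    have hW0 : 0 < W := lt_of_lt_of_le (by positivity) hWle
    have hlhs : ∑ l ∈ P, w l * volume.real (T l) = W * (2 * δ * (q - p)) := by
      rw [hW, Finset.sum_mul]
      refine Finset.sum_congr rfl fun l _ => ?_
      rw [hT, volumeReal_strip measurableSet_Icc hδ0.le, Real.volume_real_Icc_of_le hpq.le]
    have hrhs : ∑ l ∈ P, ∑ l' ∈ P, w l * w l' * volume.real (T l ∩ T l') ≤ W * (C * δ ^ 2) := by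
      rw [hW, Finset.sum_mul]
      refine Finset.sum_le_sum fun l hl => ?_
      simp only [mul_assoc (w l), ← Finset.mul_sum]
      refine mul_le_mul_of_nonneg_left ?_ (hw0 l)
      rw [hP, Finset.sum_sigma]
      refine (sum_weight_mul_volumeReal_strip_inter_le hpq.le ((le_max_left _ _).trans hL)
        ((le_max_right _ _).trans hL) hs n hwA
        (fun k hk i => by simpa using hdA k (Nat.zero_le k) hk i) hwB (fun a _ => hdB a)
        fun a' ha' => ?_).trans_eq ?_
      · have h1 := (hPA l.1 (Finset.mem_sigma.1 hl).1).2
        have h2 := (hPA a' ha').2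
        rw [mem_dyadicInterval, pow_zero, mul_one] at h1 h2
        exact (Int.abs_sub_lt_one_of_floor_eq_floor (h1.trans h2.symm)).le
      · rw [hC]
        ring
    rw [hlhs] at hCS
    have hfinal : 4 * (q - p) ^ 2 * W ≤ volume.real S * C := by
      have h1 := hCS.trans (mul_le_mul_of_nonneg_left hrhs measureReal_nonneg)
      have h2 : (W * δ ^ 2) * (4 * (q - p) ^ 2 * W) ≤ (W * δ ^ 2) * (volume.real S * C) := by
        linarith
      exact le_of_mul_le_mul_left h2 (by positivity)
    refine ENNReal.ofReal_le_of_le_toReal ?_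
    rw [← measureReal_def, div_le_iff₀ hC0]
    exact le_trans (by gcongr) hfinal
  have hlim : Filter.Tendsto (fun n : ℕ => volume (Metric.cthickening ((2 : ℝ) ^ n)⁻¹ K))
      Filter.atTop (nhds (volume K)) := by
    refine (tendsto_measure_cthickening_of_isCompact hK).comp ?_
    simp only [← inv_pow]
    exact tendsto_pow_atTop_nhds_zero_of_lt_one (by norm_num) (by norm_num)
  exact lt_of_lt_of_le (ENNReal.ofReal_pos.2 (by positivity)) (ge_of_tendsto' hlim key)

/-! ### From directions and projections to slopes and intercepts -/

theorem proj_eq (e x : Plane) : proj e x = x 0 * e 0 + x 1 * e 1 := by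
  simp [proj, PiLp.inner_apply, Fin.sum_univ_two]
  ring

/-- The unit normal with positive second coordinate of the lines of slope `a`. -/
noncomputable def unitNormal (a : ℝ) : Plane :=
  !₂[-Real.sin (Real.arctan a), Real.cos (Real.arctan a)]

theorem lipschitzWith_unitNormal : LipschitzWith 2 unitNormal := by
  have harctan : LipschitzWith 1 Real.arctan := by
    refine lipschitzWith_of_nnnorm_deriv_le Real.differentiable_arctan fun x => ?_
    rw [Real.deriv_arctan, ← NNReal.coe_le_coe, coe_nnnorm, Real.norm_eq_abs,
      abs_of_pos (by positivity), NNReal.coe_one, div_le_one (by positivity)]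
    nlinarith [sq_nonneg x]
  refine LipschitzWith.of_dist_le_mul fun x y => ?_
  have h1 := (Real.lipschitzWith_sin.comp harctan).dist_le_mul x y
  have h2 := (Real.lipschitzWith_cos.comp harctan).dist_le_mul x y
  simp only [Function.comp_apply, mul_one, NNReal.coe_one, one_mul] at h1 h2
  rw [EuclideanSpace.dist_eq, Fin.sum_univ_two]
  refine Real.sqrt_le_iff.2 ⟨by positivity, ?_⟩
  simp only [unitNormal, PiLp.toLp_apply, Matrix.cons_val_zero, Matrix.cons_val_one, dist_neg_neg,
    NNReal.coe_ofNat]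
  nlinarith [dist_nonneg (x := x) (y := y), pow_le_pow_left₀ dist_nonneg h1 2,
    pow_le_pow_left₀ dist_nonneg h2 2]

theorem sq_add_sq_eq_one_of_mem_sphere {e : Plane} (he : e ∈ Metric.sphere (0 : Plane) 1) :
    e 0 ^ 2 + e 1 ^ 2 = 1 := by
  have := EuclideanSpace.norm_sq_eq e
  simp_all [Fin.sum_univ_two]

/-- A unit vector off the horizontal axis is, up to sign, the unit normal of its perpendicular
lines. -/
theorem eq_or_eq_neg_unitNormal {e : Plane} (he : e ∈ Metric.sphere (0 : Plane) 1) (h1 : e 1 ≠ 0) :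
    e = unitNormal (-(e 0 / e 1)) ∨ e = -unitNormal (-(e 0 / e 1)) := by
  have hsq := sq_add_sq_eq_one_of_mem_sphere he
  have hroot : √(1 + (-(e 0 / e 1)) ^ 2) = |e 1|⁻¹ := by
    rw [← abs_inv, ← Real.sqrt_sq_eq_abs]
    congr 1
    field_simp
    linarith
  have hcos : Real.cos (Real.arctan (-(e 0 / e 1))) = |e 1| := by
    rw [Real.cos_arctan, hroot, one_div, inv_inv]
  have hsin : Real.sin (Real.arctan (-(e 0 / e 1))) = -(e 0 / e 1) * |e 1| := by
    rw [Real.sin_arctan, hroot, div_inv_eq_mul]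
  rcases lt_or_gt_of_ne h1 with h | h
  · right
    ext i
    fin_cases i
    · simp only [unitNormal, hsin, abs_of_neg h]
      simp
      field_simp
    · simp only [unitNormal, hcos, abs_of_neg h]
      simp
  · left
    ext i
    fin_cases i
    · simp only [unitNormal, hsin, abs_of_pos h]
      simp
      field_simp
    · simp only [unitNormal, hcos, abs_of_pos h]
      simp

/-- A set of directions of positive length has a set of perpendicular slopes of positive outer
measure. -/
theorem hausdorffMeasure_slopes_pos {E : Set Plane} (hE : E ⊆ Metric.sphere (0 : Plane) 1)
    (hE_pos : 0 < Measure.hausdorffMeasure 1 E) :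
    Measure.hausdorffMeasure 1 ((fun e : Plane => -(e 0 / e 1)) '' {e ∈ E | e 1 ≠ 0}) ≠ 0 := by
  intro h0
  set A := (fun e : Plane => -(e 0 / e 1)) '' {e ∈ E | e 1 ≠ 0} with hA
  refine hE_pos.ne' (measure_mono_null (t := {!₂[1, 0], !₂[-1, 0]} ∪
    (unitNormal '' A ∪ (fun a => -unitNormal a) '' A)) (fun e he => ?_) ?_)
  · by_cases h1 : e 1 = 0
    · left
      have hsq := sq_add_sq_eq_one_of_mem_sphere (hE he)
      rw [h1] at hsq
      rcases mul_self_eq_one_iff.1 (by linarith : e 0 * e 0 = 1) with h | h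
      · left
        ext i
        fin_cases i <;> simp [h, h1]
      · right
        ext i
        fin_cases i <;> simp [h, h1]
    · right
      have hmem : -(e 0 / e 1) ∈ A := ⟨e, ⟨he, h1⟩, rfl⟩
      exact (eq_or_eq_neg_unitNormal (hE he) h1).imp
        (fun h => ⟨_, hmem, h.symm⟩) fun h => ⟨_, hmem, h.symm⟩
  · have hnull : ∀ {f : ℝ → Plane}, LipschitzWith 2 f →
        Measure.hausdorffMeasure 1 (f '' A) = 0 := fun hf => by
      have := hf.hausdorffMeasure_image_le zero_le_one A
      rwa [h0, mul_zero, nonpos_iff_eq_zero] at this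
    have := Measure.nullSingletonClass_hausdorff Plane one_pos
    refine measure_union_null (Set.Finite.measure_zero (by simp) _) (measure_union_null
      (hnull lipschitzWith_unitNormal) (hnull lipschitzWith_unitNormal.neg))

/-- Every point of a segment in `K` perpendicular to `e` projects to `e 1` times the intercept of
the line carrying the segment. Shrinking the segment makes its shadow on the horizontal axis
an interval with rational endpoints. -/
theorem proj_image_sUnion_subset {K : Set Plane} {e : Plane} (h1 : e 1 ≠ 0) {𝓛 : Set (Set Plane)}
    (hperp : ∀ ℓ ∈ 𝓛, IsPerpSegment e ℓ) (hK : ⋃₀ 𝓛 ⊆ K) :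
    proj e '' ⋃₀ 𝓛 ⊆ ⋃ r : {r : ℚ × ℚ // r.1 < r.2}, (fun b => e 1 * b) ''
      intercepts ((fun z : Plane => (z 0, z 1)) '' K) r.1.1 r.1.2 (-(e 0 / e 1)) := by
  rintro _ ⟨z, ⟨ℓ, hℓ, hz⟩, rfl⟩
  have hℓK : ℓ ⊆ K := fun y hy => hK ⟨ℓ, hℓ, hy⟩
  obtain ⟨u, v, huv, horth, rfl⟩ := hperp ℓ hℓ
  have horth' : (v 0 - u 0) * e 0 + (v 1 - u 1) * e 1 = 0 := by
    simpa using (proj_eq e (v - u)).symm.trans horth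
  have hne : u 0 ≠ v 0 := fun h => huv <| by
    rw [h, sub_self, zero_mul, zero_add] at horth'
    have := (mul_eq_zero.1 horth').resolve_right h1
    ext i
    fin_cases i
    · exact h
    · change u 1 = v 1
      linarith
  clear huv horth hℓ
  wlog hlt : u 0 < v 0 generalizing u v
  · rw [segment_symm] at hz hℓK
    exact this v u hz hℓK (by linarith) hne.symm (lt_of_le_of_ne (not_lt.1 hlt) hne.symm)
  obtain ⟨p, hp, hp'⟩ := exists_rat_btwn hlt
  obtain ⟨q, hq, hq'⟩ := exists_rat_btwn hp'
  refine Set.mem_iUnion.2 ⟨⟨(p, q), by exact_mod_cast hq⟩, proj e z / e 1, fun x hx => ?_,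
    mul_div_cancel₀ _ h1⟩
  simp only at hx
  rw [segment_eq_image'] at hz hℓK
  obtain ⟨t, -, rfl⟩ := hz
  have hd : 0 < v 0 - u 0 := sub_pos.2 hlt
  refine ⟨u + ((x - u 0) / (v 0 - u 0)) • (v - u), hℓK ⟨_, ⟨?_, ?_⟩, rfl⟩, ?_⟩
  · exact div_nonneg (by linarith [hx.1]) hd.le
  · rw [div_le_one hd]
    linarith [hx.2]
  · rw [proj_eq]
    simp only [PiLp.add_apply, PiLp.smul_apply, PiLp.sub_apply, smul_eq_mul]
    refine Prod.ext ?_ ?_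
    · simp only
      rw [div_mul_cancel₀ _ hd.ne']
      ring
    · simp only
      have hv1 : v 1 - u 1 = -((v 0 - u 0) * e 0) / e 1 := by
        rw [eq_div_iff h1]
        linarith
      rw [hv1]
      field_simp
      ring

/-- A positive-dimensional family of segments in `K` yields one of countably many quantitative
lower bounds for a set of intercepts. -/
theorem exists_le_hausdorffContent_intercepts {K : Set Plane} {e : Plane} (h1 : e 1 ≠ 0)
    {𝓛 : Set (Set Plane)} (h𝓛 : IsPositiveDimensionalFamily e 𝓛) (hK : ⋃₀ 𝓛 ⊆ K) :
    ∃ (r : {r : ℚ × ℚ // r.1 < r.2}) (j : ℤ) (n N : ℕ),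
      ENNReal.ofReal (1 / (N + 1)) ≤ hausdorffContent (1 / (n + 1))
        (intercepts ((fun z : Plane => (z 0, z 1)) '' K) r.1.1 r.1.2 (-(e 0 / e 1)) ∩
          dyadicInterval 0 j) := by
  obtain ⟨s, hs, -, hperp, hpos⟩ := h𝓛
  obtain ⟨n, hn⟩ := exists_nat_one_div_lt hs
  have hn0 : (0 : ℝ) < 1 / (n + 1) := by positivity
  have hpos' := (hpos.trans_le (measure_mono (proj_image_sUnion_subset h1 hperp hK))).ne'
  rw [Ne, measure_iUnion_null_iff, not_forall] at hpos'
  obtain ⟨r, hr⟩ := hpos'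
  set B := intercepts ((fun z : Plane => (z 0, z 1)) '' K) r.1.1 r.1.2 (-(e 0 / e 1)) with hB
  have hBpos : Measure.hausdorffMeasure s B ≠ 0 := fun h => hr <| by
    have hlip : LipschitzWith ‖e 1‖₊ fun b => e 1 * b := lipschitzWith_smul (e 1)
    have := hlip.hausdorffMeasure_image_le hs.le B
    rwa [h, mul_zero, nonpos_iff_eq_zero] at this
  have hBU : B = ⋃ j : ℤ, B ∩ dyadicInterval 0 j := by
    rw [← Set.inter_iUnion]
    exact (Set.inter_eq_left.2 fun x _ => Set.mem_iUnion.2 ⟨_, mem_dyadicInterval.2 rfl⟩).symm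
  rw [hBU, Ne, measure_iUnion_null_iff, not_forall] at hBpos
  obtain ⟨j, hj⟩ := hBpos
  have hcont : hausdorffContent (1 / (n + 1)) (B ∩ dyadicInterval 0 j) ≠ 0 := fun h => hj <|
    nonpos_iff_eq_zero.1 <| (Measure.hausdorffMeasure_mono hn.le _).trans
      (hausdorffMeasure_eq_zero_of_hausdorffContent_eq_zero hn0 h).le
  have hfin : hausdorffContent (1 / (n + 1)) (B ∩ dyadicInterval 0 j) ≠ ⊤ :=
    ne_top_of_le_ne_top ENNReal.ofReal_ne_top
      (hausdorffContent_inter_dyadicInterval_le hn0 B 0 j)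
  obtain ⟨N, hN⟩ := exists_nat_one_div_lt (ENNReal.toReal_pos hcont hfin)
  exact ⟨r, j, n, N, ENNReal.ofReal_le_of_le_toReal hN.le⟩

theorem theorem1 (K : Set Plane) (hK : IsCompact K)
    (E : Set Plane) (hE : E ⊆ Metric.sphere (0 : Plane) 1)
    (hE_pos : 0 < Measure.hausdorffMeasure 1 E)
    (hKE : ∀ e ∈ E, ∃ 𝓛 : Set (Set Plane), IsPositiveDimensionalFamily e 𝓛 ∧ ⋃₀ 𝓛 ⊆ K) :
    0 < volume K := by
  set φ : Plane → ℝ × ℝ := fun z => (z 0, z 1) with hφ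
  have hφm : MeasurePreserving φ volume volume :=
    (volume_preserving_finTwoArrow ℝ).comp (PiLp.volume_preserving_ofLp (Fin 2))
  have hφinj : Function.Injective φ := fun x y h => by
    ext i
    fin_cases i
    exacts [congrArg Prod.fst h, congrArg Prod.snd h]
  have hK' : IsCompact (φ '' K) := hK.image (by fun_prop)
  rw [← hφinj.preimage_image K, hφm.measure_preimage hK'.measurableSet.nullMeasurableSet]
  set A : {r : ℚ × ℚ // r.1 < r.2} × ℤ × ℕ × ℕ → Set ℝ := fun d =>
    {a | ENNReal.ofReal (1 / (d.2.2.2 + 1)) ≤ hausdorffContent (1 / (d.2.2.1 + 1))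
      (intercepts (φ '' K) d.1.1.1 d.1.1.2 a ∩ dyadicInterval 0 d.2.1)} with hA
  have hcover : (fun e : Plane => -(e 0 / e 1)) '' {e ∈ E | e 1 ≠ 0} ⊆
      ⋃ d, ⋃ i : ℤ, A d ∩ dyadicInterval 0 i := by
    rintro _ ⟨e, ⟨he, h1⟩, rfl⟩
    obtain ⟨𝓛, h𝓛, h𝓛K⟩ := hKE e he
    obtain ⟨r, j, n, N, h⟩ := exists_le_hausdorffContent_intercepts h1 h𝓛 h𝓛K
    exact Set.mem_iUnion₂.2 ⟨(r, j, n, N), _, h, rfl⟩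
  -- Outer measures are countably subadditive, so one choice of all the parameters serves
  -- a set of slopes of positive outer measure.
  have hpos := mt (measure_mono_null hcover) (hausdorffMeasure_slopes_pos hE hE_pos)
  simp only [measure_iUnion_null_iff, not_forall] at hpos
  obtain ⟨⟨r, j, n, N⟩, i, hi⟩ := hpos
  refine volume_pos_of_hausdorffContent_intercepts hK' (Rat.cast_lt.2 r.2)
    (s := 1 / (n + 1)) (c := 1 / (N + 1)) (by positivity) (by positivity)
    (A := A (r, j, n, N)) (i := i) (j := j) ?_ fun a ha => ha
  exact pos_iff_ne_zero.2 fun h =>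
    hi (hausdorffMeasure_eq_zero_of_hausdorffContent_eq_zero one_pos h)
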